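/- Let $K$ be a field, let $G$ be a finite simple graph with vertex set $V=\{x_1,\dots,x_n\}$ and edge set $E$, and let $R=K[x_1,\dots,x_n]$. Let $I(G)=\langle x_ix_j \mid \{x_i,x_j\}\in E\rangle$ be the edge ideal of $G$ and let $$J=I(G)^{\vee}=\bigcap_{\{x_i,x_j\}\in E}\langle x_i,x_j\rangle$$ be its Alexander dual, the vertex cover ideal of $G$ (with $J=R$ if $E=\emptyset$). For an ideal $L$ of $R$, let $\overline{L}$ be its integral closure, that is, the set of all $x\in R$ satisfying an equation $x^k+a_1x^{k-1}+\dots+a_k=0$ with $k\ge 1$ and $a_i\in L^i$ for $1\le i\le k$. Then $\overline{J^2}=J^2$, that is, $J^2$ is integrally closed. In particular, $(J^3:J)=J^2$, where $(J^3:J)=\{f\in R\mid fJ\subseteq J^3\}$. -/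

import Mathlib

namespace CoverIdeal

/-- `x` is integral over the ideal `I`: there are `k ≥ 1` and `a i ∈ I ^ i` for `1 ≤ i ≤ k` with
`x ^ k + a 1 * x ^ (k - 1) + ⋯ + a (k - 1) * x + a k = 0`. -/
def IsIntegralOver {R : Type*} [CommRing R] (I : Ideal R) (x : R) : Prop :=
  ∃ k : ℕ, 1 ≤ k ∧ ∃ a : ℕ → R, (∀ i ∈ Finset.Icc 1 k, a i ∈ I ^ i) ∧
    x ^ k + ∑ i ∈ Finset.Icc 1 k, a i * x ^ (k - i) = 0

/-- The integral closure of an ideal `I`: the set of all elements of the ring that are integral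
over `I`. -/
def integralClosure {R : Type*} [CommRing R] (I : Ideal R) : Set R :=
  {x | IsIntegralOver I x}

/-- The square-free monomial that is the product of the variables in `s`. -/
noncomputable def sqfreeMonomial {V : Type*} (K : Type*) [Field K] (s : Finset V) :
    MvPolynomial V K :=
  ∏ v ∈ s, MvPolynomial.X v

/-- The edge ideal of a simple graph, generated by the products `X u * X v` over the edges
`{u, v}`. -/
noncomputable def edgeIdeal {V : Type*} (K : Type*) [Field K] (G : SimpleGraph V) :
    Ideal (MvPolynomial V K) :=
  Ideal.span {p | ∃ u v : V, G.Adj u v ∧ p = MvPolynomial.X u * MvPolynomial.X v}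

/-- The Alexander dual of a square-free monomial ideal `I`: the intersection of the ideals
generated by the variables of `s`, over all square-free monomials `∏ v ∈ s, X v` in `I`. By
`alexanderDual_span` below, it is enough to let the monomial run through any generating set of
square-free monomials, so this is the usual definition by generators, made independent of their
choice. -/
noncomputable def alexanderDual {V K : Type*} [Field K] (I : Ideal (MvPolynomial V K)) :
    Ideal (MvPolynomial V K) :=
  ⨅ (s : Finset V) (_ : sqfreeMonomial K s ∈ I),
    Ideal.span ((MvPolynomial.X : V → MvPolynomial V K) '' (s : Set V))

theorem sqfreeMonomial_eq {V : Type*} (K : Type*) [Field K] (s : Finset V) :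
    sqfreeMonomial K s = MvPolynomial.monomial (∑ v ∈ s, Finsupp.single v 1) 1 := by
  rw [MvPolynomial.monomial_sum_one]
  rfl

theorem exponent_apply_ne_zero_iff {V : Type*} (s : Finset V) (v : V) :
    (∑ w ∈ s, Finsupp.single w 1 : V →₀ ℕ) v ≠ 0 ↔ v ∈ s := by
  classical
  simp [Finsupp.finsetSum_apply, Finsupp.single_apply]

/-- The Alexander dual, computed from any family `F` of square-free monomial generators. -/
theorem alexanderDual_span {V K : Type*} [Field K] (F : Set (Finset V)) :
    alexanderDual (Ideal.span (sqfreeMonomial K '' F)) =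
      ⨅ s ∈ F, Ideal.span ((MvPolynomial.X : V → MvPolynomial V K) '' (s : Set V)) := by
  classical
  apply le_antisymm
  · refine le_iInf₂ fun s hs => ?_
    have h : sqfreeMonomial K s ∈ Ideal.span (sqfreeMonomial K '' F) :=
      Ideal.subset_span (Set.mem_image_of_mem _ hs)
    exact iInf_le_of_le s (iInf_le_of_le h le_rfl)
  · refine le_iInf₂ fun t ht => ?_
    have hF : sqfreeMonomial K '' F = (fun e => MvPolynomial.monomial e (1 : K)) ''
        ((fun s : Finset V => (∑ v ∈ s, Finsupp.single v 1 : V →₀ ℕ)) '' F) := by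
      rw [Set.image_image]
      exact Set.image_congr fun s _ => sqfreeMonomial_eq K s
    rw [hF, MvPolynomial.mem_ideal_span_monomial_image, sqfreeMonomial_eq] at ht
    obtain ⟨_, ⟨s, hs, rfl⟩, hle⟩ := ht (∑ v ∈ t, Finsupp.single v 1) (by
      rw [MvPolynomial.mem_support_iff, MvPolynomial.coeff_monomial, if_pos rfl]
      exact one_ne_zero)
    refine iInf_le_of_le s (iInf_le_of_le hs (Ideal.span_mono (Set.image_mono fun v hv => ?_)))
    have h1 := (exponent_apply_ne_zero_iff s v).2 hv
    have h2 := hle v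
    exact (exponent_apply_ne_zero_iff t v).1 (by simp only at h2; omega)

end CoverIdeal

open MvPolynomial

namespace CoverIdeal

/-! The proof bounds exponent vectors by weights coming from closed walks. A vertex cover has weight
at least `⌈ℓ/2⌉` along a closed walk of length `ℓ`. Lower bounds for weights scale to powers and
survive integral closure (`weight_le_of_isIntegralOver`), so an exponent `m` occurring in an element
integral over `J ^ 2` has weight at least `2⌈ℓ/2⌉`. Walks `u, v, u` give `m u + m v ≥ 2` on edges,
and odd closed walks among the vertices of value `1` are excluded. Hence these vertices induce a
bipartite graph, and a 2-colouring splits off two covers whose sum is at most `m`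
(`monomial_mem_sq`).

For the colon ideal, `f J ⊆ J ^ 3 = J ^ 2 * J` makes `f` integral over `J ^ 2` by the determinantal
trick. -/

theorem isIntegralOver_of_mem {R : Type*} [CommRing R] {I : Ideal R} {x : R} (hx : x ∈ I) :
    IsIntegralOver I x := by
  refine ⟨1, le_rfl, fun _ => -x, ?_, by simp⟩
  intro i hi
  obtain rfl : i = 1 := by simpa using hi
  simpa using hx

/-- The determinantal trick: if `x` maps a nonzero finitely generated ideal `J` of a domain into
`I * J`, then `x` is integral over `I`. -/
theorem isIntegralOver_of_forall_mul_mem {R : Type*} [CommRing R] [IsDomain R] {I J : Ideal R}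
    (hfg : J.FG) (hJ : J ≠ ⊥) {x : R} (hx : ∀ y ∈ J, x * y ∈ I * J) : IsIntegralOver I x := by
  have : Module.Finite R J := Module.Finite.iff_fg.2 hfg
  have hrange : LinearMap.range (algebraMap R (Module.End R J) x) ≤ I • ⊤ := by
    rintro _ ⟨y, rfl⟩
    have h := hx y y.2
    rw [← smul_eq_mul I J] at h
    have hmap : (I • (⊤ : Submodule R J)).map J.subtype = I • J := by
      rw [Submodule.map_smul'', Submodule.map_top, Submodule.range_subtype]
    rw [← hmap] at h
    obtain ⟨z, hz, hzy⟩ := h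
    have : z = algebraMap R (Module.End R J) x y := Subtype.ext (by simpa using hzy)
    exact this ▸ hz
  obtain ⟨p, hp, -, hcoeff, hzero⟩ :=
    LinearMap.exists_monic_and_natDegree_eq_and_coeff_mem_pow_and_aeval_eq_zero R
      (algebraMap R (Module.End R J) x) I hrange
  -- Since `p(x)` annihilates `J`, a nonzero `y ∈ J` in a domain forces `p(x) = 0`.
  obtain ⟨y, hy, hy0⟩ := Submodule.exists_mem_ne_zero_of_ne_bot hJ
  have heval : p.eval x = 0 := by
    rw [Polynomial.aeval_algebraMap_apply] at hzero
    have h := congrArg (fun g : Module.End R J => (g ⟨y, hy⟩ : R)) hzero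
    simpa [hy0, Polynomial.aeval_def] using h
  refine ⟨p.natDegree, ?_, fun i => p.coeff (p.natDegree - i), ?_, ?_⟩
  · rw [Nat.one_le_iff_ne_zero]
    intro h0
    rw [hp.natDegree_eq_zero.1 h0] at heval
    simp at heval
  · intro i hi
    have hle := (Finset.mem_Icc.1 hi).2
    simpa [Nat.sub_sub_self hle] using hcoeff (p.natDegree - i)
  · rw [Polynomial.eval_eq_sum_range, Finset.sum_range_succ, hp.coeff_natDegree, one_mul,
      ← Finset.sum_range_reflect, add_comm] at heval
    rw [← heval, ← Finset.Ico_add_one_right_eq_Icc, Finset.sum_Ico_eq_sum_range]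
    congr 1
    refine Finset.sum_congr (by simp) fun i _ => ?_
    rw [Nat.sub_sub, add_comm 1 i]

/-- If every coefficient `a i` of a monic equation for `x` is divisible by `t ^ (d * i)`, with `t`
prime, then `x` is divisible by `t ^ d`. -/
theorem pow_dvd_of_integral_equation {R : Type*} [CommRing R] [IsDomain R] {t : R} (ht : Prime t)
    {d k : ℕ} {x : R} {a : ℕ → R} (ha : ∀ i ∈ Finset.Icc 1 k, t ^ (d * i) ∣ a i)
    (hx : x ^ k + ∑ i ∈ Finset.Icc 1 k, a i * x ^ (k - i) = 0) : t ^ d ∣ x := by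
  suffices h : ∀ m ≤ d, t ^ m ∣ x from h d le_rfl
  intro m
  induction m with
  | zero => simp
  | succ m ih =>
    intro hm
    obtain ⟨y, rfl⟩ := ih (by omega)
    -- The `i`-th term is divisible by `t` to the power `d i + m (k - i) ≥ m k + i`, because `d ≥ m
    -- + 1`.
    have hdvd : t ^ (m * k + 1) ∣ ∑ i ∈ Finset.Icc 1 k, a i * (t ^ m * y) ^ (k - i) := by
      refine Finset.dvd_sum fun i hi => ?_
      obtain ⟨h1, hk⟩ := Finset.mem_Icc.1 hi
      have h : t ^ (d * i) * t ^ (m * (k - i)) ∣ a i * (t ^ m * y) ^ (k - i) := by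
        refine mul_dvd_mul (ha i hi) ?_
        rw [mul_pow, ← pow_mul]
        exact dvd_mul_right _ _
      refine dvd_trans ?_ h
      rw [← pow_add]
      refine pow_dvd_pow t ?_
      obtain ⟨j, rfl⟩ := Nat.exists_eq_add_of_le hk
      rw [Nat.add_sub_cancel_left]
      have := Nat.mul_le_mul_right i hm
      nlinarith
    have hpow : t ^ (m * k) * t ∣ t ^ (m * k) * y ^ k := by
      rw [← pow_succ, pow_mul, ← mul_pow, eq_neg_of_add_eq_zero_left hx]
      exact hdvd.neg_right
    rw [pow_succ]
    exact mul_dvd_mul_left _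
      (ht.dvd_of_dvd_pow ((mul_dvd_mul_iff_left (pow_ne_zero _ ht.ne_zero)).1 hpow))

/-! ### Monomial weights and integral closure -/

/-- The substitution `X v ↦ X v * t ^ W v`, for an additive weight `W` on exponent vectors. -/
noncomputable def weightSubst {V : Type*} (K : Type*) [Field K] (W : (V →₀ ℕ) →+ ℕ) :
    MvPolynomial V K →+* Polynomial (MvPolynomial V K) :=
  eval₂Hom (Polynomial.C.comp C)
    fun v => Polynomial.C (X v) * Polynomial.X ^ W (Finsupp.single v 1)

section WeightSubst

variable {V K : Type*} [Field K] (W : (V →₀ ℕ) →+ ℕ)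

theorem weightSubst_monomial (m : V →₀ ℕ) (c : K) :
    weightSubst K W (monomial m c) = Polynomial.monomial (W m) (monomial m c) := by
  have hW : W m = m.sum fun v e => e * W (Finsupp.single v 1) := by
    conv_lhs => rw [← m.sum_single]
    rw [map_finsuppSum]
    refine Finsupp.sum_congr fun v _ => ?_
    rw [← smul_eq_mul, ← map_nsmul, Finsupp.smul_single, smul_eq_mul, mul_one]
  rw [weightSubst, coe_eval₂Hom, eval₂_monomial, ← Polynomial.C_mul_X_pow_eq_monomial,
    monomial_eq, hW]
  simp only [Finsupp.prod, Finsupp.sum, mul_pow, Finset.prod_mul_distrib, ← pow_mul, map_mul,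
    map_prod, map_pow, RingHom.comp_apply, Finset.prod_pow_eq_pow_sum, mul_assoc]
  simp only [mul_comm]

/-- The variables `X v` are kept beside the powers of `t`, so distinct monomials of equal weight
cannot cancel. -/
theorem coeff_coeff_weightSubst (f : MvPolynomial V K) (m : V →₀ ℕ) :
    ((weightSubst K W f).coeff (W m)).coeff m = f.coeff m := by
  classical
  induction f using MvPolynomial.induction_on' with
  | monomial n c =>
    rw [weightSubst_monomial, Polynomial.coeff_monomial]
    by_cases h : n = m
    · simp [h]
    · split_ifs <;> simp [coeff_monomial, h]
  | add p q hp hq => simp [hp, hq]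

theorem X_pow_dvd_weightSubst {d : ℕ} {f : MvPolynomial V K} (hf : ∀ m ∈ f.support, d ≤ W m) :
    Polynomial.X ^ d ∣ weightSubst K W f := by
  rw [f.as_sum, map_sum]
  refine Finset.dvd_sum fun m hm => ?_
  rw [weightSubst_monomial, ← Polynomial.C_mul_X_pow_eq_monomial]
  exact (pow_dvd_pow _ (hf m hm)).mul_left _

/-- A lower bound `d` for a weight on an ideal `J` gives the lower bound `d * n` on the integral
closure of `J ^ n`. -/
theorem weight_le_of_isIntegralOver {J : Ideal (MvPolynomial V K)} {d n : ℕ}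
    (hJ : ∀ f ∈ J, ∀ m ∈ f.support, d ≤ W m) {f : MvPolynomial V K}
    (hf : IsIntegralOver (J ^ n) f) {m : V →₀ ℕ} (hm : m ∈ f.support) : d * n ≤ W m := by
  obtain ⟨k, -, a, ha, hx⟩ := hf
  have hmap : J.map (weightSubst K W) ≤ Ideal.span {Polynomial.X ^ d} := by
    rw [Ideal.map_le_iff_le_comap]
    intro g hg
    exact Ideal.mem_span_singleton.2 (X_pow_dvd_weightSubst W (hJ g hg))
  have hdvd : ∀ i ∈ Finset.Icc 1 k,
      (Polynomial.X : Polynomial (MvPolynomial V K)) ^ (d * n * i) ∣ weightSubst K W (a i) := by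
    intro i hi
    have h := Ideal.mem_map_of_mem (weightSubst K W) (ha i hi)
    rw [← pow_mul, Ideal.map_pow] at h
    have h' := Ideal.pow_right_mono hmap (n * i) h
    rwa [Ideal.span_singleton_pow, Ideal.mem_span_singleton, ← pow_mul, ← mul_assoc] at h'
  have hx' := congrArg (weightSubst K W) hx
  simp only [map_add, map_sum, map_mul, map_pow, map_zero] at hx'
  have h := Polynomial.X_pow_dvd_iff.1
    (pow_dvd_of_integral_equation Polynomial.prime_X hdvd hx')
  by_contra! hlt
  have h0 := coeff_coeff_weightSubst W f m
  rw [h _ hlt, coeff_zero] at h0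
  exact mem_support_iff.1 hm h0.symm

end WeightSubst

/-! ### Vertex covers and closed walks -/

section Cover

variable {V K : Type*} [Field K] {G : SimpleGraph V}

theorem mem_alexanderDual_edgeIdeal {f : MvPolynomial V K} :
    f ∈ alexanderDual (edgeIdeal K G) ↔
      ∀ m ∈ f.support, ∀ u v, G.Adj u v → m u ≠ 0 ∨ m v ≠ 0 := by
  classical
  have hspan : edgeIdeal K G =
      Ideal.span (sqfreeMonomial K '' {s | ∃ u v, G.Adj u v ∧ s = {u, v}}) := by
    rw [edgeIdeal]
    congr 1
    ext p
    constructor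
    · rintro ⟨u, v, h, rfl⟩
      exact ⟨{u, v}, ⟨u, v, h, rfl⟩, Finset.prod_pair h.ne⟩
    · rintro ⟨_, ⟨u, v, h, rfl⟩, rfl⟩
      exact ⟨u, v, h, Finset.prod_pair h.ne⟩
  rw [hspan, alexanderDual_span]
  simp only [Submodule.mem_iInf, mem_ideal_span_X_image]
  constructor
  · intro h m hm u v huv
    simpa using h {u, v} ⟨u, v, huv, rfl⟩ m hm
  · rintro h _ ⟨u, v, huv, rfl⟩ m hm
    simpa using h m hm u v huv

theorem monomial_mem_alexanderDual {m : V →₀ ℕ} (c : K)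
    (hm : ∀ u v, G.Adj u v → m u ≠ 0 ∨ m v ≠ 0) :
    monomial m c ∈ alexanderDual (edgeIdeal K G) := by
  refine mem_alexanderDual_edgeIdeal.2 fun n hn => ?_
  obtain rfl := Finset.mem_singleton.1 (support_monomial_subset hn)
  exact hm

/-- The sum of an exponent vector over the vertices of a walk, the first one excluded. -/
def walkWeight {u v : V} (p : G.Walk u v) : (V →₀ ℕ) →+ ℕ where
  toFun m := (p.support.tail.map m).sum
  map_zero' := List.sum_eq_zero fun x hx => by
    obtain ⟨_, -, rfl⟩ := List.mem_map.1 hx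
    rfl
  map_add' m n := List.sum_map_add

theorem walkWeight_apply {u v : V} (p : G.Walk u v) (m : V →₀ ℕ) :
    walkWeight p m = (p.support.tail.map m).sum := rfl

theorem walkWeight_cons {u v w : V} (h : G.Adj u v) (p : G.Walk v w) (m : V →₀ ℕ) :
    walkWeight (.cons h p) m = m v + walkWeight p m := by
  rw [walkWeight_apply, walkWeight_apply, SimpleGraph.Walk.support_cons, List.tail_cons,
    ← SimpleGraph.Walk.cons_tail_support p, List.map_cons, List.sum_cons, List.tail_cons]

/-- Each step of the walk has endpoint values summing to at least `1`; adding over all steps counts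
interior positions twice and the two ends once. For `u = v` the end terms cancel. -/
theorem length_add_le_of_cover {m : V →₀ ℕ} (hm : ∀ u v, G.Adj u v → m u ≠ 0 ∨ m v ≠ 0)
    {u v : V} (p : G.Walk u v) : p.length + m v ≤ 2 * walkWeight p m + m u := by
  induction p with
  | nil => simp [walkWeight_apply]
  | cons h p ih =>
    have := hm _ _ h
    rw [walkWeight_cons, SimpleGraph.Walk.length_cons]
    omega

/-- The weight inequality that a closed walk gives on the integral closure of the square of the
vertex cover ideal. -/
theorem two_mul_le_walkWeight {f : MvPolynomial V K}
    (hf : IsIntegralOver (alexanderDual (edgeIdeal K G) ^ 2) f) {m : V →₀ ℕ} (hm : m ∈ f.support)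
    {u : V} (p : G.Walk u u) : (p.length + 1) / 2 * 2 ≤ walkWeight p m := by
  refine weight_le_of_isIntegralOver (walkWeight p) (fun g hg n hn => ?_) hf hm
  have := length_add_le_of_cover (mem_alexanderDual_edgeIdeal.1 hg n hn) p
  omega

/-- The subgraph of `G` on the vertices where `m` takes the value `1`. -/
def oneGraph (G : SimpleGraph V) (m : V →₀ ℕ) : SimpleGraph V where
  Adj u v := G.Adj u v ∧ m u = 1 ∧ m v = 1
  symm := ⟨fun _ _ h => ⟨h.1.symm, h.2.2, h.2.1⟩⟩
  loopless := ⟨fun v h => G.loopless.irrefl v h.1⟩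

theorem oneGraph_le (m : V →₀ ℕ) : oneGraph G m ≤ G := fun _ _ h => h.1

theorem walkWeight_mapLe_oneGraph {m : V →₀ ℕ} {u v : V} (p : (oneGraph G m).Walk u v) :
    walkWeight (p.mapLe (oneGraph_le m)) m = p.length := by
  induction p with
  | nil => rfl
  | cons h p ih =>
    rw [SimpleGraph.Walk.mapLe, SimpleGraph.Walk.map_cons, walkWeight_cons, ih, SimpleGraph.Hom.ofLE_apply,
      h.2.2, SimpleGraph.Walk.length_cons, add_comm]

/-- An exponent vector that satisfies the edge inequalities, and whose value-one vertices induce a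
bipartite graph, dominates the sum of two vertex covers. -/
theorem monomial_mem_sq {m : V →₀ ℕ} (hedge : ∀ u v, G.Adj u v → 2 ≤ m u + m v)
    (hcol : (oneGraph G m).Colorable 2) (c : K) :
    monomial m c ∈ alexanderDual (edgeIdeal K G) ^ 2 := by
  classical
  obtain ⟨φ⟩ := hcol
  -- Vertices of value at least `2` serve both covers; those of value `1` are divided by colour. An
  -- edge missed by one cover would have both ends of value `1` and of the same colour.
  let cover (i : Fin 2) : V →₀ ℕ :=
    Finsupp.onFinset m.support (fun v => if 2 ≤ m v ∨ m v = 1 ∧ φ v = i then 1 else 0) (by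
      intro v hv
      rw [Finsupp.mem_support_iff]
      intro h0
      simp [h0] at hv)
  have hcover (i : Fin 2) : monomial (cover i) (1 : K) ∈ alexanderDual (edgeIdeal K G) := by
    refine monomial_mem_alexanderDual 1 fun u v huv => ?_
    have h2 := hedge u v huv
    by_contra! hzero
    simp only [cover, Finsupp.onFinset_apply, ite_eq_right_iff, one_ne_zero, imp_false, not_or,
      not_and, not_le] at hzero
    have hu : m u = 1 := by omega
    have hv : m v = 1 := by omega
    have hne := φ.valid (show (oneGraph G m).Adj u v from ⟨huv, hu, hv⟩)
    have := hzero.1.2 hu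
    have := hzero.2.2 hv
    omega
  have hle : cover 0 + cover 1 ≤ m := by
    intro v
    simp only [cover, Finsupp.add_apply, Finsupp.onFinset_apply]
    split_ifs <;> omega
  have hm : monomial m c =
      monomial (m - (cover 0 + cover 1)) c * (monomial (cover 0) 1 * monomial (cover 1) 1) := by
    rw [monomial_mul, monomial_mul, tsub_add_cancel_of_le hle, one_mul, mul_one]
  rw [hm, pow_two]
  exact Ideal.mul_mem_left _ _ (Ideal.mul_mem_mul (hcover 0) (hcover 1))

theorem monomial_mem_sq_of_isIntegralOver {f : MvPolynomial V K}
    (hf : IsIntegralOver (alexanderDual (edgeIdeal K G) ^ 2) f) {m : V →₀ ℕ}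
    (hm : m ∈ f.support) (c : K) : monomial m c ∈ alexanderDual (edgeIdeal K G) ^ 2 := by
  refine monomial_mem_sq (fun u v huv => ?_) ?_ c
  · have h := two_mul_le_walkWeight hf hm (.cons huv (.cons huv.symm .nil))
    simp [walkWeight_apply] at h
    omega
  · rw [SimpleGraph.two_colorable_iff_forall_loop_even]
    intro u p
    -- Here the weight equals the length `ℓ`, and `2⌈ℓ/2⌉ ≤ ℓ` forces `ℓ` to be even.
    have h := two_mul_le_walkWeight hf hm (p.mapLe (oneGraph_le m))
    rw [walkWeight_mapLe_oneGraph, SimpleGraph.Walk.length_mapLe] at h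
    rw [Nat.even_iff]
    omega

theorem alexanderDual_edgeIdeal_ne_bot [Finite V] : alexanderDual (edgeIdeal K G) ≠ ⊥ := by
  intro h
  have hmem : monomial (Finsupp.equivFunOnFinite.symm fun _ => 1) (1 : K) ∈
      alexanderDual (edgeIdeal K G) :=
    monomial_mem_alexanderDual 1 fun u v _ => Or.inl (by simp)
  rw [h, Ideal.mem_bot, monomial_eq_zero] at hmem
  exact one_ne_zero hmem

end Cover

end CoverIdeal

theorem propositionP1 {V : Type*} [Finite V] {K : Type*} [Field K] (G : SimpleGraph V)
    (J : Ideal (MvPolynomial V K))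
    (hJ : J = CoverIdeal.alexanderDual (CoverIdeal.edgeIdeal K G)) :
    CoverIdeal.integralClosure (J ^ 2) = ((J ^ 2 : Ideal (MvPolynomial V K)) :
      Set (MvPolynomial V K)) ∧
    Submodule.colon (J ^ 3) (J : Set (MvPolynomial V K)) = J ^ 2 := by
  subst hJ
  have hclosed : ∀ f : MvPolynomial V K,
      CoverIdeal.IsIntegralOver (CoverIdeal.alexanderDual (CoverIdeal.edgeIdeal K G) ^ 2) f →
      f ∈ CoverIdeal.alexanderDual (CoverIdeal.edgeIdeal K G) ^ 2 := by
    intro f hf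
    rw [f.as_sum]
    exact sum_mem fun m hm => CoverIdeal.monomial_mem_sq_of_isIntegralOver hf hm _
  refine ⟨Set.Subset.antisymm hclosed fun f hf => CoverIdeal.isIntegralOver_of_mem hf,
    le_antisymm (fun f hf => ?_) fun f hf => ?_⟩
  · refine hclosed f (CoverIdeal.isIntegralOver_of_forall_mul_mem (IsNoetherian.noetherian _)
      (CoverIdeal.alexanderDual_edgeIdeal_ne_bot (G := G)) fun y hy => ?_)
    rw [← pow_succ]
    exact Submodule.mem_colon.1 hf y hy
  · refine Submodule.mem_colon.2 fun y hy => ?_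
    rw [smul_eq_mul, pow_succ]
    exact Ideal.mul_mem_mul hf hy
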